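/- Theorem 2 (Gaussian random series). Let $(a_n)_{n\ge 1}$ be a sequence of real or complex numbers and let $(X_n)_{n\ge 1}$ be a Gaussian sequence of identically distributed real or complex random variables with zero mean, defined on one probability space. Here "Gaussian sequence" means that the variables are jointly Gaussian: for every $N$ the real vector $(\operatorname{Re}X_1,\operatorname{Im}X_1,\dots,\operatorname{Re}X_N,\operatorname{Im}X_N)$ is a (possibly degenerate) Gaussian vector. No independence and, in the complex case, no circular symmetry is assumed. If $$\sum_{n,m=1}^\infty |a_n|\,|a_m|\,\bigl|\mathbb{E}(X_n\overline{X_m})\bigr| < \infty,$$ then the series $\sum_{n=1}^\infty a_n X_n$ converges almost surely, that is, for almost every $\omega$ the partial sums $\sum_{n=1}^N a_n X_n(\omega)$ converge to a finite limit as $N\to\infty$. -/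

import Mathlib

open MeasureTheory ProbabilityTheory Filter
open scoped Topology ComplexConjugate

/-!
Let `S N` be the partial sums of `∑ a n * X n` and put
`u i = ∑' j, ‖a i‖ * ‖a j‖ * ‖E (X i * conj (X j))‖`, a summable sequence by hypothesis. Expanding
the square gives `E ‖S m - S n‖ ^ 2 ≤ ∑ i ∈ [n, m), u i` (`lintegral_enorm_sum_sq_le`). The
increment `S m - S n` is a centered Gaussian variable, so its fourth moment is controlled by the
square of its second moment (`HasGaussianLaw.lintegral_enorm_pow_four_le`), whence
`E ‖S m - S n‖ ^ 4 ≤ C * (∑ i ∈ [n, m), u i) ^ 2`.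

The exponent on the right is larger than `1`, and this is exactly what lets the maximum over a
block obey the same bound, up to a constant, as a single increment: by the Billingsley–Móricz bisection
argument (`lintegral_iSup_enorm_sub_pow_four_le`),
`E max_{n ≤ k ≤ m} ‖S k - S n‖ ^ 4 ≤ K * C * (∑ i ∈ [n, m), u i) ^ 2`. Letting first `m` and then
`n` tend to infinity, `inf_n sup_{k ≥ n} ‖S k - S n‖` vanishes almost surely, i.e. `S` is almost
surely a Cauchy sequence (`ae_tendsto_of_lintegral_enorm_sub_pow_four_le`).
-/

open scoped ENNReal NNReal

/-! ### A maximal inequality from fourth moments of increments -/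

/-- The point of this inequality is that the coefficient of `b ^ 4` is less than `2`: this leaves
room for absorption in the bisection argument. -/
lemma ENNReal.add_pow_four_le (a b : ℝ≥0∞) :
    (a + b) ^ 4 ≤ 3 / 2 * b ^ 4 + 11 ^ 4 * a ^ 4 := by
  rcases eq_or_ne a ∞ with rfl | ha
  · simp [ENNReal.mul_top]
  rcases eq_or_ne b ∞ with rfl | hb
  · simp [ENNReal.mul_top, ENNReal.div_eq_zero_iff]
  lift a to ℝ≥0 using ha
  lift b to ℝ≥0 using hb
  have key : (a + b) ^ 4 ≤ 3 / 2 * b ^ 4 + 11 ^ 4 * a ^ 4 := by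
    rw [← NNReal.coe_le_coe]
    push_cast
    have ha := a.coe_nonneg
    have hb := b.coe_nonneg
    rcases le_total (10 * (a : ℝ)) b with h | h
    -- `(11 / 10) ^ 4 = 1.4641 < 3 / 2`
    · calc ((a : ℝ) + b) ^ 4 ≤ (11 / 10 * b) ^ 4 := by gcongr; linarith
        _ = 14641 / 10000 * (b : ℝ) ^ 4 := by ring
        _ ≤ 3 / 2 * (b : ℝ) ^ 4 + 11 ^ 4 * (a : ℝ) ^ 4 := by
          nlinarith [pow_nonneg ha 4, pow_nonneg hb 4]
    · calc ((a : ℝ) + b) ^ 4 ≤ (11 * a) ^ 4 := by gcongr; linarith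
        _ = 11 ^ 4 * (a : ℝ) ^ 4 := by ring
        _ ≤ 3 / 2 * (b : ℝ) ^ 4 + 11 ^ 4 * (a : ℝ) ^ 4 := by
          nlinarith [pow_nonneg hb 4]
  have h2 : ((3 / 2 : ℝ≥0) : ℝ≥0∞) = 3 / 2 := by
    rw [ENNReal.coe_div (by norm_num)]; norm_num
  rw [← h2]
  exact_mod_cast key

section MaximalInequality

variable {Ω E : Type*} [MeasurableSpace Ω] {P : Measure Ω} [NormedAddCommGroup E]
  {S : ℕ → Ω → E} {C : ℝ≥0∞} {u : ℕ → ℝ≥0}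

/-- There is an index `h` in `[n, m)` such that the blocks on either side of `h` each carry at most
half of the total mass of `u` on `[n, m)`; the mass at `h` itself may be arbitrarily large. -/
lemma exists_bisection (u : ℕ → ℝ≥0) {n m : ℕ} (hnm : n < m) :
    ∃ h, n ≤ h ∧ h < m ∧ 2 * ∑ i ∈ Finset.Ico n h, u i ≤ ∑ i ∈ Finset.Ico n m, u i ∧
      2 * ∑ i ∈ Finset.Ico (h + 1) m, u i ≤ ∑ i ∈ Finset.Ico n m, u i := by
  classical
  -- `h` is the first index at which the accumulated mass reaches half of the total.
  have hex : ∃ h, n ≤ h ∧ ∑ i ∈ Finset.Ico n m, u i ≤ 2 * ∑ i ∈ Finset.Ico n (h + 1), u i := by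
    refine ⟨m - 1, by omega, ?_⟩
    rw [Nat.sub_add_cancel (by omega), two_mul]
    exact le_self_add
  have hlt : Nat.find hex < m := by
    refine lt_of_le_of_lt (Nat.find_min' hex (m := m - 1) ⟨by omega, ?_⟩) (by omega)
    rw [Nat.sub_add_cancel (by omega), two_mul]
    exact le_self_add
  obtain ⟨hn, hs⟩ := Nat.find_spec hex
  refine ⟨Nat.find hex, hn, hlt, ?_, ?_⟩
  · rcases hn.eq_or_lt with he | hl
    · simp [← he]
    · have := Nat.find_min hex (m := Nat.find hex - 1) (by omega)
      rw [Nat.sub_add_cancel (by omega)] at this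
      by_contra hc
      exact this ⟨by omega, (not_le.1 hc).le⟩
  · have hsplit := Finset.sum_Ico_consecutive u (hn.trans (Nat.le_succ _)) (Nat.succ_le_of_lt hlt)
    simp only [Nat.succ_eq_add_one] at hsplit
    generalize Nat.find hex = h at hs hsplit ⊢
    rw [← hsplit, ← NNReal.coe_le_coe] at hs ⊢
    push_cast at hs ⊢
    linarith

/-- Maximal inequality of Billingsley and Móricz for fourth moments: if the fourth moment of every
increment is bounded by the square of an additive interval function, then so is, up to a constant,
the fourth moment of the maximal increment over a block. The proof is by induction on the length of
the block, bisected by `exists_bisection`. Each half contributes at most a quarter of the bound,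
because the exponent is `2`; the constant `K = 4 * 11 ^ 4` solves `3 / 4 * K + 11 ^ 4 = K`. -/
lemma lintegral_iSup_enorm_sub_pow_four_le
    (hS : ∀ n m, AEMeasurable (fun ω ↦ ‖S m ω - S n ω‖ₑ) P)
    (hC : ∀ n m, n ≤ m → ∫⁻ ω, ‖S m ω - S n ω‖ₑ ^ 4 ∂P ≤ C * (∑ i ∈ Finset.Ico n m, u i : ℝ≥0) ^ 2)
    {n m : ℕ} (hnm : n ≤ m) :
    ∫⁻ ω, ⨆ k ∈ Finset.Icc n m, ‖S k ω - S n ω‖ₑ ^ 4 ∂P ≤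
      4 * 11 ^ 4 * C * (∑ i ∈ Finset.Ico n m, u i : ℝ≥0) ^ 2 := by
  induction hd : m - n using Nat.strong_induction_on generalizing n m with
  | _ d ih =>
  rcases hnm.eq_or_lt with rfl | hlt
  · simp
  obtain ⟨h, hn, hm, h₁, h₂⟩ := exists_bisection u hlt
  have ih₁ := ih (h - n) (by omega) hn rfl
  have ih₂ := ih (m - (h + 1)) (by omega) (Nat.succ_le_of_lt hm) rfl
  have hmeas : ∀ p q, AEMeasurable (fun ω ↦ ⨆ k ∈ Finset.Icc p q, ‖S k ω - S p ω‖ₑ ^ 4) P :=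
    fun p q ↦ AEMeasurable.biSup _ (Finset.countable_toSet _) fun k _ ↦ (hS p k).pow_const 4
  set U := ∑ i ∈ Finset.Ico n m, u i
  have hhalf : ∀ {x : ℝ≥0}, 2 * x ≤ U → 4 * (x : ℝ≥0∞) ^ 2 ≤ (U : ℝ≥0∞) ^ 2 := fun {x} hx ↦ by
    have : (2 * x) ^ 2 ≤ U ^ 2 := by gcongr
    rw [mul_pow] at this
    norm_num at this
    exact_mod_cast this
  have hpt : ∀ ω, ⨆ k ∈ Finset.Icc n m, ‖S k ω - S n ω‖ₑ ^ 4 ≤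
      3 / 2 * ((⨆ k ∈ Finset.Icc n h, ‖S k ω - S n ω‖ₑ ^ 4) +
        ⨆ k ∈ Finset.Icc (h + 1) m, ‖S k ω - S (h + 1) ω‖ₑ ^ 4) +
      11 ^ 4 * ‖S (h + 1) ω - S n ω‖ₑ ^ 4 := by
    intro ω
    refine iSup₂_le fun k hk ↦ ?_
    rw [Finset.mem_Icc] at hk
    rcases Nat.lt_or_ge h k with hkh | hkh
    · calc ‖S k ω - S n ω‖ₑ ^ 4
          ≤ (‖S (h + 1) ω - S n ω‖ₑ + ‖S k ω - S (h + 1) ω‖ₑ) ^ 4 := by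
            gcongr
            rw [← sub_add_sub_cancel (S k ω) (S (h + 1) ω) (S n ω), add_comm]
            exact enorm_add_le _ _
        _ ≤ _ := ENNReal.add_pow_four_le _ _
        _ ≤ _ := by
            gcongr
            refine le_add_left ?_
            exact le_iSup₂_of_le k (Finset.mem_Icc.2 ⟨hkh, hk.2⟩) le_rfl
    · refine le_add_right ?_
      calc ‖S k ω - S n ω‖ₑ ^ 4 ≤ 1 * ⨆ k ∈ Finset.Icc n h, ‖S k ω - S n ω‖ₑ ^ 4 := by
            rw [one_mul]
            exact le_iSup₂_of_le (f := fun k _ ↦ ‖S k ω - S n ω‖ₑ ^ 4) k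
              (Finset.mem_Icc.2 ⟨hk.1, hkh⟩) le_rfl
        _ ≤ _ := by
            gcongr
            · rw [ENNReal.le_div_iff_mul_le (by simp) (by simp)]; norm_num
            · exact le_self_add
  -- The recursion for the constant closes up, with denominators cleared.
  have h32 : (4 * 11 ^ 4 * C) * (3 / 2) * U ^ 2 * 2 + 11 ^ 4 * C * (4 * U ^ 2) =
      4 * (4 * 11 ^ 4 * C * U ^ 2) := by
    have : (3 / 2 : ℝ≥0∞) * 2 = 3 := ENNReal.div_mul_cancel (by simp) (by simp)
    calc _ = 4 * 11 ^ 4 * C * U ^ 2 * (3 / 2 * 2) + 4 * 11 ^ 4 * C * U ^ 2 := by ring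
      _ = _ := by rw [this]; ring
  refine (ENNReal.mul_le_mul_iff_right (a := 4) (by simp) (by simp)).1 ?_
  rw [← h32]
  calc _ ≤ 4 * ∫⁻ ω, (3 / 2 * ((⨆ k ∈ Finset.Icc n h, ‖S k ω - S n ω‖ₑ ^ 4) +
        ⨆ k ∈ Finset.Icc (h + 1) m, ‖S k ω - S (h + 1) ω‖ₑ ^ 4) +
      11 ^ 4 * ‖S (h + 1) ω - S n ω‖ₑ ^ 4) ∂P := by gcongr with ω; exact hpt ω
    _ = 4 * (3 / 2 * ((∫⁻ ω, ⨆ k ∈ Finset.Icc n h, ‖S k ω - S n ω‖ₑ ^ 4 ∂P) +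
        ∫⁻ ω, ⨆ k ∈ Finset.Icc (h + 1) m, ‖S k ω - S (h + 1) ω‖ₑ ^ 4 ∂P) +
      11 ^ 4 * ∫⁻ ω, ‖S (h + 1) ω - S n ω‖ₑ ^ 4 ∂P) := by
      rw [lintegral_add_left' (((hmeas _ _).fun_add (hmeas _ _)).const_mul _),
        lintegral_const_mul'' _ ((hmeas _ _).fun_add (hmeas _ _)), lintegral_add_left' (hmeas _ _),
        lintegral_const_mul'' _ ((hS _ _).pow_const 4)]
    _ ≤ 4 * (3 / 2 * (4 * 11 ^ 4 * C * (∑ i ∈ Finset.Ico n h, u i : ℝ≥0) ^ 2 +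
        4 * 11 ^ 4 * C * (∑ i ∈ Finset.Ico (h + 1) m, u i : ℝ≥0) ^ 2) +
      11 ^ 4 * (C * U ^ 2)) := by
      gcongr
      refine (hC n (h + 1) (by omega)).trans ?_
      gcongr
      exact Finset.sum_le_sum_of_subset (Finset.Ico_subset_Ico_right hm)
    _ = 4 * 11 ^ 4 * C * (3 / 2) * (4 * (∑ i ∈ Finset.Ico n h, u i : ℝ≥0) ^ 2) +
        4 * 11 ^ 4 * C * (3 / 2) * (4 * (∑ i ∈ Finset.Ico (h + 1) m, u i : ℝ≥0) ^ 2) +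
        11 ^ 4 * C * (4 * U ^ 2) := by ring
    _ ≤ 4 * 11 ^ 4 * C * (3 / 2) * U ^ 2 + 4 * 11 ^ 4 * C * (3 / 2) * U ^ 2 +
        11 ^ 4 * C * (4 * U ^ 2) := by
      gcongr <;> exact hhalf ‹_›
    _ = _ := by ring

/-- Almost sure convergence criterion: fourth moments of increments dominated by the squared block
sums of a summable sequence. -/
lemma ae_tendsto_of_lintegral_enorm_sub_pow_four_le [CompleteSpace E]
    (hS : ∀ n m, AEMeasurable (fun ω ↦ ‖S m ω - S n ω‖ₑ) P) (hCtop : C ≠ ∞)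
    (hC : ∀ n m, n ≤ m → ∫⁻ ω, ‖S m ω - S n ω‖ₑ ^ 4 ∂P ≤ C * (∑ i ∈ Finset.Ico n m, u i : ℝ≥0) ^ 2)
    (hu : Summable u) :
    ∀ᵐ ω ∂P, ∃ s, Tendsto (fun n ↦ S n ω) atTop (𝓝 s) := by
  have hmeas : ∀ p q, AEMeasurable (fun ω ↦ ⨆ k ∈ Finset.Icc p q, ‖S k ω - S p ω‖ₑ ^ 4) P :=
    fun p q ↦ AEMeasurable.biSup _ (Finset.countable_toSet _) fun k _ ↦ (hS p k).pow_const 4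
  -- `F n` is the supremum of `‖S k - S n‖ₑ ^ 4` over all `k ≥ n`, written as a monotone limit.
  set F : ℕ → Ω → ℝ≥0∞ := fun n ω ↦ ⨆ m, ⨆ k ∈ Finset.Icc n m, ‖S k ω - S n ω‖ₑ ^ 4
  have hFmeas : ∀ n, AEMeasurable (F n) P := fun n ↦ AEMeasurable.iSup fun m ↦ hmeas n m
  have hFint : ∀ n, ∫⁻ ω, F n ω ∂P ≤ 4 * 11 ^ 4 * C * (∑' i, u (i + n) : ℝ≥0) ^ 2 := by
    intro n
    rw [lintegral_iSup' (fun m ↦ hmeas n m)]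
    · refine iSup_le fun m ↦ ?_
      rcases le_total n m with h | h
      · refine (lintegral_iSup_enorm_sub_pow_four_le hS hC h).trans ?_
        gcongr
        rw [Finset.sum_Ico_eq_sum_range]
        simp_rw [add_comm n]
        exact ((NNReal.summable_nat_add_iff n).2 hu).sum_le_tsum _ (by simp)
      -- Here `Icc n m` has at most the point `n`, where the increment is zero.
      · rcases h.eq_or_lt with rfl | h
        · simp
        · simp [Finset.Icc_eq_empty_of_lt h]
    · refine ae_of_all _ fun ω p q hpq ↦ ?_
      exact biSup_mono fun k hk ↦ Finset.Icc_subset_Icc_right hpq hk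
  have hlim : Tendsto (fun n ↦ 4 * 11 ^ 4 * C * ((∑' i, u (i + n) : ℝ≥0) : ℝ≥0∞) ^ 2)
      atTop (𝓝 0) := by
    have h0 : Tendsto (fun n ↦ ((∑' i, u (i + n) : ℝ≥0) : ℝ≥0∞) ^ 2) atTop (𝓝 (0 ^ 2)) :=
      (ENNReal.continuous_pow 2).continuousAt.tendsto.comp
        (ENNReal.tendsto_coe.2 (NNReal.tendsto_sum_nat_add u))
    simpa using ENNReal.Tendsto.const_mul h0
      (Or.inr (ENNReal.mul_ne_top (by finiteness) hCtop))
  have hzero : ∫⁻ ω, ⨅ n, F n ω ∂P = 0 := by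
    refine le_antisymm (ge_of_tendsto' hlim fun n ↦ ?_) zero_le
    exact (lintegral_mono fun ω ↦ iInf_le _ n).trans (hFint n)
  rw [lintegral_eq_zero_iff' (AEMeasurable.iInf hFmeas)] at hzero
  filter_upwards [hzero] with ω hω
  refine cauchySeq_tendsto_of_complete (EMetric.cauchySeq_iff'.2 fun ε hε ↦ ?_)
  have hε4 : ⨅ n, F n ω < ε ^ 4 := by
    rw [show ⨅ n, F n ω = 0 from hω]
    exact pos_of_ne_zero (pow_ne_zero 4 hε.ne')
  obtain ⟨n, hn⟩ := iInf_lt_iff.1 hε4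
  refine ⟨n, fun k hk ↦ ?_⟩
  rw [edist_eq_enorm_sub]
  refine (ENNReal.pow_lt_pow_left_iff four_ne_zero).1 (lt_of_le_of_lt ?_ hn)
  refine le_iSup_of_le k ?_
  exact le_iSup₂_of_le (f := fun k _ ↦ ‖S k ω - S n ω‖ₑ ^ 4) k
    (Finset.mem_Icc.2 ⟨hk, le_rfl⟩) le_rfl

end MaximalInequality

/-! ### Moments of centered Gaussian variables -/

section GaussianMoments

variable {Ω : Type*} [MeasurableSpace Ω] {P : Measure Ω}

lemma lintegral_enorm_sq_gaussianReal_zero_one : ∫⁻ x, ‖x‖ₑ ^ 2 ∂gaussianReal 0 1 = 1 := by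
  have h := variance_fun_id_gaussianReal (μ := 0) (v := 1)
  rw [variance_of_integral_eq_zero (by fun_prop) (by simp)] at h
  have h2 := ofReal_integral_eq_lintegral_ofReal (f := fun x : ℝ ↦ x ^ 2) (μ := gaussianReal 0 1)
    (memLp_id_gaussianReal 2).integrable_sq (ae_of_all _ fun x ↦ sq_nonneg x)
  rw [h] at h2
  simp only [NNReal.coe_one, ENNReal.ofReal_one] at h2
  rw [h2]
  refine lintegral_congr fun x ↦ ?_
  rw [← sq_abs, ENNReal.ofReal_pow (abs_nonneg x), Real.enorm_eq_ofReal_abs]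

lemma lintegral_enorm_pow_four_gaussianReal_ne_top :
    ∫⁻ x, ‖x‖ₑ ^ 4 ∂gaussianReal 0 1 ≠ ∞ := by
  have h := (memLp_id_gaussianReal (μ := 0) (v := 1) 4).eLpNorm_lt_top
  have := (eLpNorm_lt_top_iff_lintegral_rpow_enorm_lt_top (by simp) (by simp)).1 h
  have h4 : ∀ x : ℝ, ‖id x‖ₑ ^ ((4 : ℝ≥0) : ℝ≥0∞).toReal = ‖x‖ₑ ^ 4 := fun x ↦ by
    rw [← ENNReal.rpow_natCast]
    simp
  simp_rw [h4] at this
  exact this.ne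

/-- A centered real Gaussian variable is in law a multiple of a standard one, so its fourth moment
scales as the square of its second moment. The value `3` of the constant plays no role. -/
lemma ProbabilityTheory.HasGaussianLaw.lintegral_enorm_pow_four_eq {Y : Ω → ℝ}
    (hY : HasGaussianLaw Y P)
    (h0 : ∫ ω, Y ω ∂P = 0) :
    ∫⁻ ω, ‖Y ω‖ₑ ^ 4 ∂P =
      (∫⁻ x, ‖x‖ₑ ^ 4 ∂gaussianReal 0 1) * (∫⁻ ω, ‖Y ω‖ₑ ^ 2 ∂P) ^ 2 := by
  obtain ⟨c, hc⟩ : ∃ c : ℝ, P.map Y = (gaussianReal 0 1).map (c * ·) := by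
    refine ⟨√(Var[Y; P]), ?_⟩
    rw [hY.map_eq_gaussianReal, gaussianReal_map_const_mul, h0]
    congr 1
    · simp
    · ext; simp [Real.sq_sqrt (variance_nonneg Y P), variance_nonneg Y P]
  have hp : ∀ p : ℕ, ∫⁻ ω, ‖Y ω‖ₑ ^ p ∂P = ‖c‖ₑ ^ p * ∫⁻ x, ‖x‖ₑ ^ p ∂gaussianReal 0 1 := by
    intro p
    calc ∫⁻ ω, ‖Y ω‖ₑ ^ p ∂P = ∫⁻ x, ‖x‖ₑ ^ p ∂(P.map Y) := by
          rw [lintegral_map' (by fun_prop) hY.aemeasurable]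
      _ = ∫⁻ x, ‖c * x‖ₑ ^ p ∂gaussianReal 0 1 := by
          rw [hc, lintegral_map (by fun_prop) (by fun_prop)]
      _ = _ := by
          simp_rw [enorm_mul, mul_pow]
          rw [lintegral_const_mul _ (by fun_prop)]
  rw [hp, hp, lintegral_enorm_sq_gaussianReal_zero_one]
  ring

/-- Complex version, for a Gaussian law over `ℝ` that need not be circularly symmetric: the real and
imaginary parts are estimated separately. -/
lemma ProbabilityTheory.HasGaussianLaw.lintegral_enorm_pow_four_le {Z : Ω → ℂ}
    (hZ : HasGaussianLaw Z P)
    (h0 : ∫ ω, Z ω ∂P = 0) :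
    ∫⁻ ω, ‖Z ω‖ₑ ^ 4 ∂P ≤
      16 * (∫⁻ x, ‖x‖ₑ ^ 4 ∂gaussianReal 0 1) * (∫⁻ ω, ‖Z ω‖ₑ ^ 2 ∂P) ^ 2 := by
  have hre : HasGaussianLaw (fun ω ↦ (Z ω).re) P := hZ.map_fun Complex.reCLM
  have him : HasGaussianLaw (fun ω ↦ (Z ω).im) P := hZ.map_fun Complex.imCLM
  have hre0 : ∫ ω, (Z ω).re ∂P = 0 := by
    simpa [h0] using Complex.reCLM.integral_comp_comm hZ.integrable
  have him0 : ∫ ω, (Z ω).im ∂P = 0 := by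
    simpa [h0] using Complex.imCLM.integral_comp_comm hZ.integrable
  have hre_le : ∀ z : ℂ, ‖z.re‖ₑ ≤ ‖z‖ₑ := fun z ↦
    enorm_le_iff_norm_le.2 (by simpa using Complex.abs_re_le_norm z)
  have him_le : ∀ z : ℂ, ‖z.im‖ₑ ≤ ‖z‖ₑ := fun z ↦
    enorm_le_iff_norm_le.2 (by simpa using Complex.abs_im_le_norm z)
  have hadd : ∀ z : ℂ, ‖z‖ₑ ≤ ‖z.re‖ₑ + ‖z.im‖ₑ := fun z ↦ by
    have h := enorm_add_le (z.re : ℂ) (z.im * Complex.I)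
    rw [Complex.re_add_im, enorm_mul] at h
    simpa [← ofReal_norm] using h
  calc ∫⁻ ω, ‖Z ω‖ₑ ^ 4 ∂P
      ≤ ∫⁻ ω, 8 * (‖(Z ω).re‖ₑ ^ 4 + ‖(Z ω).im‖ₑ ^ 4) ∂P := by
        gcongr with ω
        refine (pow_le_pow_left' (hadd (Z ω)) 4).trans ?_
        have := ENNReal.rpow_add_le_mul_rpow_add_rpow ‖(Z ω).re‖ₑ ‖(Z ω).im‖ₑ
          (p := (4 : ℕ)) (by norm_num)
        rw [show ((4 : ℕ) : ℝ) - 1 = (3 : ℕ) by norm_num] at this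
        simp only [ENNReal.rpow_natCast] at this
        rwa [show (2 : ℝ≥0∞) ^ 3 = 8 by norm_num] at this
    _ = 8 * ((∫⁻ x, ‖x‖ₑ ^ 4 ∂gaussianReal 0 1) * (∫⁻ ω, ‖(Z ω).re‖ₑ ^ 2 ∂P) ^ 2 +
          (∫⁻ x, ‖x‖ₑ ^ 4 ∂gaussianReal 0 1) * (∫⁻ ω, ‖(Z ω).im‖ₑ ^ 2 ∂P) ^ 2) := by
        have hm := hre.aemeasurable.enorm.pow_const 4
        have hm' := him.aemeasurable.enorm.pow_const 4
        rw [lintegral_const_mul'' _ (hm.fun_add hm'), lintegral_add_left' hm,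
          hre.lintegral_enorm_pow_four_eq hre0, him.lintegral_enorm_pow_four_eq him0]
    _ ≤ 8 * ((∫⁻ x, ‖x‖ₑ ^ 4 ∂gaussianReal 0 1) * (∫⁻ ω, ‖Z ω‖ₑ ^ 2 ∂P) ^ 2 +
          (∫⁻ x, ‖x‖ₑ ^ 4 ∂gaussianReal 0 1) * (∫⁻ ω, ‖Z ω‖ₑ ^ 2 ∂P) ^ 2) := by
        gcongr
        · exact hre_le _
        · exact him_le _
    _ = _ := by ring

/-! ### Second moments of linear combinations -/

lemma lintegral_enorm_sum_sq_le {ι : Type*} {X : ι → Ω → ℂ} (hX : ∀ i, MemLp (X i) 2 P) (a : ι → ℂ)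
    (s : Finset ι) :
    ∫⁻ ω, ‖∑ i ∈ s, a i * X i ω‖ₑ ^ 2 ∂P ≤
      (∑ i ∈ s, ∑ j ∈ s, ‖a i‖₊ * ‖a j‖₊ * ‖∫ ω, X i ω * conj (X j ω) ∂P‖₊ : ℝ≥0) := by
  have hint : ∀ i j, Integrable (fun ω ↦ X i ω * conj (X j ω)) P := fun i j ↦
    (hX i).integrable_mul (hX j).star
  have hexp : ∀ ω, (‖∑ i ∈ s, a i * X i ω‖ ^ 2 : ℂ) =
      ∑ i ∈ s, ∑ j ∈ s, a i * conj (a j) * (X i ω * conj (X j ω)) := fun ω ↦ by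
    rw [← Complex.mul_conj', map_sum, Finset.sum_mul_sum]
    refine Finset.sum_congr rfl fun i _ ↦ Finset.sum_congr rfl fun j _ ↦ ?_
    rw [map_mul]
    ring
  have hL : MemLp (fun ω ↦ ∑ i ∈ s, a i * X i ω) 2 P :=
    memLp_finsetSum s fun i _ ↦ (hX i).const_mul (a i)
  have hsq : ∫⁻ ω, ‖∑ i ∈ s, a i * X i ω‖ₑ ^ 2 ∂P =
      ENNReal.ofReal (∫ ω, ‖∑ i ∈ s, a i * X i ω‖ ^ 2 ∂P) := by
    rw [ofReal_integral_eq_lintegral_ofReal hL.norm.integrable_sq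
      (ae_of_all _ fun _ ↦ sq_nonneg _)]
    refine lintegral_congr fun ω ↦ ?_
    rw [ENNReal.ofReal_pow (norm_nonneg _), ofReal_norm]
  have hval : ((∫ ω, ‖∑ i ∈ s, a i * X i ω‖ ^ 2 ∂P : ℝ) : ℂ) =
      ∑ i ∈ s, ∑ j ∈ s, a i * conj (a j) * ∫ ω, X i ω * conj (X j ω) ∂P := by
    rw [← integral_complex_ofReal]
    push_cast
    simp_rw [hexp]
    rw [integral_finsetSum _ fun i _ ↦ integrable_finsetSum _ fun j _ ↦ (hint i j).const_mul _]
    refine Finset.sum_congr rfl fun i _ ↦ ?_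
    rw [integral_finsetSum _ fun j _ ↦ (hint i j).const_mul _]
    exact Finset.sum_congr rfl fun j _ ↦ integral_const_mul _ _
  rw [hsq]
  refine ENNReal.ofReal_le_of_le_toReal ?_
  rw [ENNReal.coe_toReal]
  push_cast
  calc ∫ ω, ‖∑ i ∈ s, a i * X i ω‖ ^ 2 ∂P
      ≤ ‖((∫ ω, ‖∑ i ∈ s, a i * X i ω‖ ^ 2 ∂P : ℝ) : ℂ)‖ := by
        rw [Complex.norm_real]; exact Real.le_norm_self _
    _ ≤ _ := by
        rw [hval]
        refine norm_sum_le_of_le _ fun i _ ↦ norm_sum_le_of_le _ fun j _ ↦ ?_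
        simp

end GaussianMoments

/-! ### Gaussian random series -/

/-- `IsGaussianProcess X P` says that `(X n)` is a (jointly) Gaussian sequence: every finite
subfamily has a Gaussian law as a vector over `ℝ`, i.e. its real and imaginary parts are jointly
Gaussian, possibly degenerate. Circular symmetry is not required, and real-valued sequences (and
real coefficients) are the special case of vanishing imaginary parts. The sequences are indexed
from `0`. Convergence is convergence of the partial sums in the given order. -/
theorem theorem2 {Ω : Type*} [MeasurableSpace Ω] (P : Measure Ω) [IsProbabilityMeasure P]
    (a : ℕ → ℂ) (X : ℕ → Ω → ℂ)
    (hGauss : IsGaussianProcess X P)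
    (hIdent : ∀ n m : ℕ, IdentDistrib (X n) (X m) P P)
    (hMean : ∀ n : ℕ, ∫ ω, X n ω ∂P = 0)
    (hSum : Summable fun p : ℕ × ℕ =>
      ‖a p.1‖ * ‖a p.2‖ * ‖∫ ω, X p.1 ω * conj (X p.2 ω) ∂P‖) :
    ∀ᵐ ω ∂P, ∃ s : ℂ,
      Tendsto (fun N : ℕ => ∑ n ∈ Finset.range N, a n * X n ω) atTop (𝓝 s) := by
  set f : ℕ × ℕ → ℝ≥0 := fun p ↦ ‖a p.1‖₊ * ‖a p.2‖₊ * ‖∫ ω, X p.1 ω * conj (X p.2 ω) ∂P‖₊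
    with hf_def
  have hf : Summable f := by
    rw [← NNReal.summable_coe]
    simpa [hf_def] using hSum
  have hY : IsGaussianProcess (fun n ω ↦ a n * X n ω) P :=
    hGauss.comp_left fun n ↦ ContinuousLinearMap.mul ℝ ℂ (a n)
  have hsub : ∀ n m, n ≤ m → ∀ ω, ∑ i ∈ Finset.range m, a i * X i ω -
      ∑ i ∈ Finset.range n, a i * X i ω = ∑ i ∈ Finset.Ico n m, a i * X i ω :=
    fun n m h ω ↦ (Finset.sum_Ico_eq_sub _ h).symm
  refine ae_tendsto_of_lintegral_enorm_sub_pow_four_le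
    (C := 16 * ∫⁻ x, ‖x‖ₑ ^ 4 ∂gaussianReal 0 1) (u := fun i ↦ ∑' j, f (i, j)) ?_
    (ENNReal.mul_ne_top (by simp) lintegral_enorm_pow_four_gaussianReal_ne_top) ?_ ?_
  · intro n m
    have := fun n ↦ hY.aemeasurable n
    fun_prop
  · intro n m hnm
    simp_rw [hsub n m hnm]
    refine (hY.hasGaussianLaw_fun_sum.lintegral_enorm_pow_four_le ?_).trans ?_
    · rw [integral_finsetSum _ fun i _ ↦ (hY.hasGaussianLaw_eval i).integrable]
      simp [integral_const_mul, hMean]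
    · gcongr
      refine (lintegral_enorm_sum_sq_le (fun i ↦ (hGauss.hasGaussianLaw_eval i).memLp_two) a
        _).trans ?_
      gcongr with i
      exact (NNReal.summable_comp_injective hf (Prod.mk_right_injective i)).sum_le_tsum
        (f := fun j ↦ f (i, j)) _ (by simp)
  · rw [← NNReal.summable_coe] at hf ⊢
    simpa only [NNReal.coe_tsum] using hf.prod
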